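/- Let $E\in\mathbb R^{n\times n}$, $C\in\mathbb R^{q\times n}$, let $A(\theta)\in\mathbb R^{n\times n}$ depend on $\theta\in\mathbb R^p$ with entries differentiable at $\theta_0$, and consider the linear descriptor system $$E\dot x=A(\theta)x,\qquad \dot\theta=0,\qquad y=Cx,$$ that is, $F(x,\dot x,\theta)=A(\theta)x-E\dot x$ and $h(x)=Cx$. For $\mu\ge 0$ put $\sigma=\mu+1$ and $z=(x,\dot x,\dots,x^{(\sigma)})\in\mathbb R^{(\sigma+1)n}$; let $\bar F_\mu(\theta,z)$ and $\bar H_\mu(\theta,z)$ collect the time derivatives of orders $0,\dots,\mu$ of $F(x,\dot x,\theta)$ and $h(x)$ (with $\theta$ constant), written as functions of $(\theta,z)$, and let the identifiability matrix (with equal differentiation orders $\mu=\nu$) be $$\mathcal I(\theta,z)=\begin{bmatrix}\partial\bar F_\mu/\partial\theta&\partial\bar F_\mu/\partial z\\ \partial\bar H_\mu/\partial\theta&\partial\bar H_\mu/\partial z\end{bmatrix}(\theta,z).$$ Let $\Delta_1=[\,I_\sigma\ \ 0\,]$ and $\Delta_2=[\,0\ \ I_\sigma\,]$, both of size $\sigma\times(\sigma+1)$.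 (1) For every $\mu\ge 0$ and every $z$, $$\mathcal I(\theta_0,z)=\begin{bmatrix}\mathcal I_{11}(\theta_0,z)&\Delta_1\otimes A(\theta_0)-\Delta_2\otimes E\\ 0&\Delta_1\otimes C\end{bmatrix},\qquad \mathcal I_{11}(\theta,z)=\frac{\partial}{\partial\theta}\begin{bmatrix}A(\theta)x\\ A(\theta)\dot x\\ \vdots\\ A(\theta)x^{(\mu)}\end{bmatrix}.$$ (2) Let $x_0$ be a consistent state at $\theta_0$ whose initial value problem $E\dot x=A(\theta_0)x$, $x(t_0)=x_0$, has exactly one solution $x(\cdot)$ on some interval $[t_0,t_0+T]$, $T>0$. If for some $\mu=\nu$ $$\operatorname{rank}\mathcal I(\theta_0,z_0)=p+\operatorname{rank}\begin{bmatrix}\Delta_1\otimes A(\theta_0)-\Delta_2\otimes E\\ \Delta_1\otimes C\end{bmatrix},\qquad z_0=(x,\dot x,\dots,x^{(\sigma)})(t_0),$$ then the system is locally identifiable at $x_0$ with respect to $\theta_0$: there is a neighborhood $\mathcal U\subseteq\mathbb R^p$ of $\theta_0$ such that for every $\theta'\in\mathcal U$, $\theta'\ne\theta_0$, on some finite time interval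 $[t_0,t_0+T']$, $T'>0$, the output $Cx(t)$ of the (unique) solution of $E\dot x=A(\theta_0)x$, $x(t_0)=x_0$, differs from the output $Cx'(t)$ of every solution of $E\dot x'=A(\theta')x'$ with $Ex'(t_0)=Ex_0$ (in particular, of every solution with $x'(t_0)=x_0$). -/

import Mathlib

open scoped Matrix Kronecker Topology

noncomputable section

namespace DescriptorSystem

/-! Descriptor systems `0 = F(x, ẋ, θ)`, `y = h(x, θ)` with state `x ∈ ℝⁿ`, output `y ∈ ℝ^q` and
constant parameter `θ ∈ ℝ^p`. -/

/-- `x` solves `0 = F(x, ẋ, θ)` on the interval `[t₀, t₀ + T]` (one-sided derivatives at the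
two end points). -/
def IsTrajectory {n p : ℕ} (F : (Fin n → ℝ) → (Fin n → ℝ) → (Fin p → ℝ) → (Fin n → ℝ))
    (θ : Fin p → ℝ) (t₀ T : ℝ) (x : ℝ → Fin n → ℝ) : Prop :=
  ∀ t ∈ Set.Icc t₀ (t₀ + T),
    ∃ v : Fin n → ℝ, HasDerivWithinAt x v (Set.Icc t₀ (t₀ + T)) t ∧ F (x t) v θ = 0

/-- `x` is *the* trajectory `t ↦ Φ_{t - t₀}(x₀; θ)` on `[t₀, t₀ + T]`: it solves the system, starts
at `x₀`, and is the only solution starting at `x₀`. In particular `x₀` is a consistent state. -/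
def IsFlow {n p : ℕ} (F : (Fin n → ℝ) → (Fin n → ℝ) → (Fin p → ℝ) → (Fin n → ℝ))
    (θ : Fin p → ℝ) (t₀ T : ℝ) (x₀ : Fin n → ℝ) (x : ℝ → Fin n → ℝ) : Prop :=
  IsTrajectory F θ t₀ T x ∧ x t₀ = x₀ ∧
    ∀ y : ℝ → Fin n → ℝ, IsTrajectory F θ t₀ T y → y t₀ = x₀ →
      Set.EqOn y x (Set.Icc t₀ (t₀ + T))

/-- Local identifiability at `x₀` with respect to `θ₀`: for every `θ' ≠ θ₀` near `θ₀`, the output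
generated from `x₀` by the system with parameter `θ₀` differs, on some finite time interval
`[t₀, t₀ + T]`, from the output generated from `x₀` by the system with parameter `θ'`.

The state `x₀` need not satisfy the algebraic constraints of the system with parameter `θ'`.
So the initial condition for `θ'` is imposed on the differential variables only, `π (x' t₀) = π x₀`.
For `π = id` this says that `x'` starts exactly at `x₀`; every other `π` admits at least these
trajectories `x'`, and gives a stronger notion. -/
def LocallyIdentifiableAt {n p q : ℕ}
    (F : (Fin n → ℝ) → (Fin n → ℝ) → (Fin p → ℝ) → (Fin n → ℝ))
    (h : (Fin n → ℝ) → (Fin p → ℝ) → (Fin q → ℝ))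
    (π : (Fin n → ℝ) → (Fin n → ℝ)) (t₀ : ℝ) (x₀ : Fin n → ℝ) (θ₀ : Fin p → ℝ) : Prop :=
  ∃ U ∈ 𝓝 θ₀, ∀ θ' ∈ U, θ' ≠ θ₀ →
    ∃ T : ℝ, 0 < T ∧ ∃ x : ℝ → Fin n → ℝ, IsFlow F θ₀ t₀ T x₀ x ∧
      ∀ x' : ℝ → Fin n → ℝ, IsTrajectory F θ' t₀ T x' → π (x' t₀) = π x₀ →
        ∃ t ∈ Set.Icc t₀ (t₀ + T), h (x t) θ₀ ≠ h (x' t) θ'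

/-- The matrix of first-order partial derivatives of `f` at `a`. -/
def jacobian {ι κ : Type*} [Fintype κ] [DecidableEq κ]
    (f : (κ → ℝ) → ι → ℝ) (a : κ → ℝ) : Matrix ι κ ℝ :=
  Matrix.of fun i j => fderiv ℝ (fun u => f u i) a (Pi.single j 1)

/-- The polynomial curve whose derivatives at time `0` up to order `σ` are the blocks
`x, ẋ, …, x^(σ)` of `z`. -/
def jetCurve {n : ℕ} (σ : ℕ) (z : Fin (σ + 1) × Fin n → ℝ) (t : ℝ) : Fin n → ℝ :=
  fun i => ∑ j : Fin (σ + 1), t ^ (j : ℕ) / ((j : ℕ).factorial : ℝ) * z (j, i)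

/-- The derivative array `F̄_μ(θ, z)`: the time derivatives of orders `0, …, μ` of `F(x, ẋ, θ)`,
with `θ` constant, as functions of `θ` and `z = (x, ẋ, …, x^(σ))`, where `μ + 1 ≤ σ`.
(By the chain rule they depend on the curve `x` only through `z`, so any curve with these
derivatives can be used.) -/
def stateArray {n p : ℕ} (F : (Fin n → ℝ) → (Fin n → ℝ) → (Fin p → ℝ) → (Fin n → ℝ))
    (μ σ : ℕ) (θ : Fin p → ℝ) (z : Fin (σ + 1) × Fin n → ℝ) : Fin (μ + 1) × Fin n → ℝ :=
  fun r => iteratedDeriv (r.1 : ℕ)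
    (fun t => F (jetCurve σ z t) (deriv (jetCurve σ z) t) θ r.2) 0

/-- The derivative array `H̄_ν(θ, z)`: the time derivatives of orders `0, …, ν` of `h(x, θ)`,
as functions of `θ` and `z = (x, ẋ, …, x^(σ))`, where `ν ≤ σ`. -/
def outputArray {n p q : ℕ} (h : (Fin n → ℝ) → (Fin p → ℝ) → (Fin q → ℝ))
    (ν σ : ℕ) (θ : Fin p → ℝ) (z : Fin (σ + 1) × Fin n → ℝ) : Fin (ν + 1) × Fin q → ℝ :=
  fun r => iteratedDeriv (r.1 : ℕ) (fun t => h (jetCurve σ z t) θ r.2) 0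

/-- The identifiability matrix
`[∂F̄_μ/∂θ, ∂F̄_μ/∂z; ∂H̄_ν/∂θ, ∂H̄_ν/∂z]` of the pair `{F, h}` at `(θ, z)`. -/
def identifiabilityMatrix {n p q : ℕ}
    (F : (Fin n → ℝ) → (Fin n → ℝ) → (Fin p → ℝ) → (Fin n → ℝ))
    (h : (Fin n → ℝ) → (Fin p → ℝ) → (Fin q → ℝ))
    (μ ν σ : ℕ) (θ : Fin p → ℝ) (z : Fin (σ + 1) × Fin n → ℝ) :
    Matrix ((Fin (μ + 1) × Fin n) ⊕ (Fin (ν + 1) × Fin q)) (Fin p ⊕ (Fin (σ + 1) × Fin n)) ℝ :=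
  Matrix.fromBlocks
    (jacobian (fun θ' => stateArray F μ σ θ' z) θ) (jacobian (fun z' => stateArray F μ σ θ z') z)
    (jacobian (fun θ' => outputArray h ν σ θ' z) θ) (jacobian (fun z' => outputArray h ν σ θ z') z)

/-- The vector `z = (x, ẋ, …, x^(σ))` of the signal `x` on `[t₀, t₀ + T]` at the time `t₀`. -/
def jetAt {n : ℕ} (σ : ℕ) (t₀ T : ℝ) (x : ℝ → Fin n → ℝ) : Fin (σ + 1) × Fin n → ℝ :=
  fun r => iteratedDerivWithin (r.1 : ℕ) x (Set.Icc t₀ (t₀ + T)) t₀ r.2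

/-! Linear systems `E ẋ = A(θ) x`, `y = C x`. -/

/-- `F(x, ẋ, θ) = A(θ) x - E ẋ`. -/
def linearF {n p : ℕ} (E : Matrix (Fin n) (Fin n) ℝ)
    (A : (Fin p → ℝ) → Matrix (Fin n) (Fin n) ℝ) :
    (Fin n → ℝ) → (Fin n → ℝ) → (Fin p → ℝ) → (Fin n → ℝ) :=
  fun x v θ => A θ *ᵥ x - E *ᵥ v

/-- `h(x, θ) = C x`. -/
def linearH {n q : ℕ} (p : ℕ) (C : Matrix (Fin q) (Fin n) ℝ) :
    (Fin n → ℝ) → (Fin p → ℝ) → (Fin q → ℝ) :=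
  fun x _ => C *ᵥ x

/-- `Δ₁ = [I_σ 0]`, of size `σ × (σ + 1)`. -/
def Δ₁ (σ : ℕ) : Matrix (Fin σ) (Fin (σ + 1)) ℝ :=
  Matrix.of fun i j => if j = i.castSucc then 1 else 0

/-- `Δ₂ = [0 I_σ]`, of size `σ × (σ + 1)`. -/
def Δ₂ (σ : ℕ) : Matrix (Fin σ) (Fin (σ + 1)) ℝ :=
  Matrix.of fun i j => if j = i.succ then 1 else 0

/-- `𝓘₁₁(θ, z) = ∂/∂θ [A(θ) x; A(θ) ẋ; …; A(θ) x^(μ)]`, where `z = (x, ẋ, …, x^(μ + 1))`. -/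
def I₁₁ {n p : ℕ} (A : (Fin p → ℝ) → Matrix (Fin n) (Fin n) ℝ) (μ : ℕ)
    (θ : Fin p → ℝ) (z : Fin (μ + 1 + 1) × Fin n → ℝ) :
    Matrix (Fin (μ + 1) × Fin n) (Fin p) ℝ :=
  jacobian (fun θ' (r : Fin (μ + 1) × Fin n) => (A θ' *ᵥ fun i => z (r.1.castSucc, i)) r.2) θ

end DescriptorSystem

end

namespace DescriptorSystem

/-! Part (1) holds because both derivative arrays are linear in `z`. Part (2) is by contraposition;
the output matrix is called `G` in its lemmas.

A unique flow forces the pencil of `(E, A θ₀)` to be regular, and regularity persists near `θ₀`.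
Trajectories then solve linear ODEs (`exists_linearMap_hasDerivWithinAt`), so their jets at `t₀`
satisfy `E ξ (k + 1) = A ξ k`. If `θ` yields the same output as `θ₀`, the difference `D` of the two
jets, read as a power series, satisfies `(E - X A(θ)) D = X (A(θ) - A(θ₀)) ξ` and `G D = 0`.
Multiplying by the adjugate gives `G adj(E - X A(θ)) (A(θ) - A(θ₀)) ξ = 0`
(`forcedOutput_sub_eq_zero`), which involves no division by the determinant and is therefore
continuous in `A(θ)`.

If such `θ ≠ θ₀` accumulate at `θ₀`, dividing by `‖θ - θ₀‖` and passing to the limit yields a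
direction `δ ≠ 0` with `G adj(E - X A(θ₀)) (∂_δ A) ξ = 0` (`exists_direction_of_frequently`). Only
now is the determinant divided out, up to a power of `X`. This produces a jet `d` such that `(δ, d)`
lies in the kernel of the identifiability matrix (`exists_jet_of_forcedOutput_eq_zero`), and the
rank condition forces `δ = 0` (`eq_zero_of_rank_fromCols_eq`). -/

/-! ### Derivative arrays and the block form of the identifiability matrix -/

theorem contDiff_jetCurve_apply {n σ : ℕ} (z : Fin (σ + 1) × Fin n → ℝ) (i : Fin n) :
    ContDiff ℝ (⊤ : ℕ∞) fun t => jetCurve σ z t i := by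
  unfold jetCurve
  fun_prop

theorem iteratedDeriv_jetCurve_apply {n σ : ℕ} (z : Fin (σ + 1) × Fin n → ℝ) (i : Fin n)
    (k : Fin (σ + 1)) : iteratedDeriv (k : ℕ) (fun t => jetCurve σ z t i) 0 = z (k, i) := by
  unfold jetCurve
  rw [iteratedDeriv_fun_sum (fun j _ => by fun_prop), Finset.sum_eq_single k]
  · have : (fun t : ℝ => t ^ (k : ℕ) / ((k : ℕ).factorial : ℝ) * z (k, i)) =
        fun t : ℝ => (z (k, i) / ((k : ℕ).factorial : ℝ)) * t ^ (k : ℕ) := by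
      ext t; ring
    rw [this, iteratedDeriv_const_mul_field, iteratedDeriv_fun_pow_zero, if_pos rfl,
      div_mul_cancel₀ _ (by positivity)]
  · intro j _ hj
    have : (fun t : ℝ => t ^ (j : ℕ) / ((j : ℕ).factorial : ℝ) * z (j, i)) =
        fun t : ℝ => (z (j, i) / ((j : ℕ).factorial : ℝ)) * t ^ (j : ℕ) := by
      ext t; ring
    rw [this, iteratedDeriv_const_mul_field, iteratedDeriv_fun_pow_zero,
      if_neg (fun h => hj (Fin.ext h.symm)), Nat.cast_zero, mul_zero]
  · simp

theorem deriv_jetCurve_apply {n σ : ℕ} (z : Fin (σ + 1) × Fin n → ℝ) (t : ℝ) (i : Fin n) :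
    deriv (jetCurve σ z) t i = deriv (fun t => jetCurve σ z t i) t := by
  rw [deriv_pi fun j => ((contDiff_jetCurve_apply z j).differentiable (by simp)).differentiableAt]

theorem iteratedDeriv_mulVec_apply {n m : ℕ} (M : Matrix (Fin m) (Fin n) ℝ) (f : ℝ → Fin n → ℝ)
    (hf : ∀ j, ContDiff ℝ (⊤ : ℕ∞) fun t => f t j) (k : ℕ) (i : Fin m) (s : ℝ) :
    iteratedDeriv k (fun t => (M *ᵥ f t) i) s =
      (M *ᵥ fun j => iteratedDeriv k (fun t => f t j) s) i := by
  simp only [Matrix.mulVec, dotProduct]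
  rw [iteratedDeriv_fun_sum fun j _ =>
    (contDiff_const.mul ((hf j).of_le (mod_cast le_top))).contDiffAt]
  simp only [iteratedDeriv_const_mul_field]

theorem stateArray_linearF {n p : ℕ} (E : Matrix (Fin n) (Fin n) ℝ)
    (A : (Fin p → ℝ) → Matrix (Fin n) (Fin n) ℝ) (μ : ℕ) (θ : Fin p → ℝ)
    (z : Fin (μ + 1 + 1) × Fin n → ℝ) (r : Fin (μ + 1) × Fin n) :
    stateArray (linearF E A) μ (μ + 1) θ z r =
      (A θ *ᵥ fun j => z (r.1.castSucc, j)) r.2 - (E *ᵥ fun j => z (r.1.succ, j)) r.2 := by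
  have hf := contDiff_jetCurve_apply (σ := μ + 1) z
  have hd : ∀ j, ContDiff ℝ (⊤ : ℕ∞) fun t => deriv (jetCurve (μ + 1) z) t j := fun j => by
    simp only [deriv_jetCurve_apply]
    exact (contDiff_infty_iff_deriv.1 (hf j)).2
  have hM : ∀ (M : Matrix (Fin n) (Fin n) ℝ) (f : ℝ → Fin n → ℝ),
      (∀ j, ContDiff ℝ (⊤ : ℕ∞) fun t => f t j) →
      ContDiffAt ℝ (r.1 : ℕ) (fun t => (M *ᵥ f t) r.2) 0 := fun M f h => by
    simp only [Matrix.mulVec, dotProduct]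
    exact (ContDiff.sum fun j _ => contDiff_const.mul ((h j).of_le (mod_cast le_top))).contDiffAt
  unfold stateArray linearF
  simp only [Pi.sub_apply]
  rw [show (fun t => (A θ *ᵥ jetCurve (μ + 1) z t) r.2 -
      (E *ᵥ deriv (jetCurve (μ + 1) z) t) r.2) = (fun t => (A θ *ᵥ jetCurve (μ + 1) z t) r.2) -
      fun t => (E *ᵥ deriv (jetCurve (μ + 1) z) t) r.2 from rfl,
    iteratedDeriv_sub (hM _ _ hf) (hM _ _ hd), iteratedDeriv_mulVec_apply _ _ hf,
    iteratedDeriv_mulVec_apply _ _ hd]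
  simp only [deriv_jetCurve_apply]
  have h₁ : ∀ j, iteratedDeriv (r.1 : ℕ) (fun t => jetCurve (μ + 1) z t j) 0 =
      z (r.1.castSucc, j) := fun j => iteratedDeriv_jetCurve_apply z j r.1.castSucc
  have h₂ : ∀ j, iteratedDeriv (r.1 : ℕ) (fun t => deriv (fun s => jetCurve (μ + 1) z s j) t) 0 =
      z (r.1.succ, j) := fun j => by
    rw [← iteratedDeriv_jetCurve_apply z j r.1.succ, Fin.val_succ, iteratedDeriv_succ']
  simp only [h₁, h₂]

theorem outputArray_linearH {n p q : ℕ} (C : Matrix (Fin q) (Fin n) ℝ) (μ : ℕ) (θ : Fin p → ℝ)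
    (z : Fin (μ + 1 + 1) × Fin n → ℝ) (r : Fin (μ + 1) × Fin q) :
    outputArray (linearH p C) μ (μ + 1) θ z r = (C *ᵥ fun j => z (r.1.castSucc, j)) r.2 := by
  unfold outputArray linearH
  rw [iteratedDeriv_mulVec_apply _ _ (contDiff_jetCurve_apply (σ := μ + 1) z)]
  congr 2
  ext j
  exact iteratedDeriv_jetCurve_apply z j r.1.castSucc

theorem Δ₁_kronecker_mulVec {n m σ : ℕ} (M : Matrix (Fin m) (Fin n) ℝ)
    (z : Fin (σ + 1) × Fin n → ℝ) (r : Fin σ × Fin m) :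
    ((Δ₁ σ ⊗ₖ M) *ᵥ z) r = (M *ᵥ fun j => z (r.1.castSucc, j)) r.2 := by
  simp [Matrix.mulVec, dotProduct, Fintype.sum_prod_type, Δ₁, ite_mul]

theorem Δ₂_kronecker_mulVec {n m σ : ℕ} (M : Matrix (Fin m) (Fin n) ℝ)
    (z : Fin (σ + 1) × Fin n → ℝ) (r : Fin σ × Fin m) :
    ((Δ₂ σ ⊗ₖ M) *ᵥ z) r = (M *ᵥ fun j => z (r.1.succ, j)) r.2 := by
  simp [Matrix.mulVec, dotProduct, Fintype.sum_prod_type, Δ₂, ite_mul]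

theorem jacobian_mulVec {ι κ : Type*} [Fintype κ] [DecidableEq κ] (M : Matrix ι κ ℝ) (a : κ → ℝ) :
    jacobian (fun z => M *ᵥ z) a = M := by
  ext i j
  have h : HasFDerivAt (fun u => (M *ᵥ u) i)
      ((LinearMap.proj i ∘ₗ M.mulVecLin).toContinuousLinearMap) a :=
    (LinearMap.proj i ∘ₗ M.mulVecLin).toContinuousLinearMap.hasFDerivAt
  simp [jacobian, h.fderiv]

theorem identifiabilityMatrix_linear {n p q : ℕ}
    (E : Matrix (Fin n) (Fin n) ℝ) (A : (Fin p → ℝ) → Matrix (Fin n) (Fin n) ℝ)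
    (C : Matrix (Fin q) (Fin n) ℝ) (θ₀ : Fin p → ℝ) (μ : ℕ) (z : Fin (μ + 1 + 1) × Fin n → ℝ) :
    identifiabilityMatrix (linearF E A) (linearH p C) μ μ (μ + 1) θ₀ z =
      Matrix.fromBlocks (I₁₁ A μ θ₀ z) (Δ₁ (μ + 1) ⊗ₖ A θ₀ - Δ₂ (μ + 1) ⊗ₖ E)
        0 (Δ₁ (μ + 1) ⊗ₖ C) := by
  unfold identifiabilityMatrix
  congr 1
  · ext r j
    simp only [jacobian, I₁₁, stateArray_linearF, Matrix.of_apply, fderiv_sub_const]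
  · rw [← jacobian_mulVec (Δ₁ (μ + 1) ⊗ₖ A θ₀ - Δ₂ (μ + 1) ⊗ₖ E) z]
    congr 1
    ext z' r
    rw [stateArray_linearF, Matrix.sub_mulVec, Pi.sub_apply, Δ₁_kronecker_mulVec,
      Δ₂_kronecker_mulVec]
  · ext r j
    simp [jacobian, outputArray_linearH]
  · rw [← jacobian_mulVec (Δ₁ (μ + 1) ⊗ₖ C) z]
    congr 1
    ext z' r
    rw [outputArray_linearH, Δ₁_kronecker_mulVec]

/-! ### The rank condition -/

/-- If adjoining the columns of `L` to those of `R` raises the rank by the number of columns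
of `L`, these columns are independent modulo the range of `R`. -/
theorem eq_zero_of_rank_fromCols_eq {m p k : Type*} [Fintype m] [Fintype p] [Fintype k]
    [DecidableEq p] [DecidableEq k]
    (L : Matrix m p ℝ) (R : Matrix m k ℝ)
    (h : (Matrix.fromCols L R).rank = Fintype.card p + R.rank) {δ : p → ℝ} {d : k → ℝ}
    (hd : L *ᵥ δ + R *ᵥ d = 0) : δ = 0 := by
  have hsup : LinearMap.range (Matrix.fromCols L R).mulVecLin =
      LinearMap.range L.mulVecLin ⊔ LinearMap.range R.mulVecLin := by
    apply le_antisymm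
    · rintro _ ⟨v, rfl⟩
      rw [Matrix.mulVecLin_apply, Matrix.fromCols_mulVec]
      exact Submodule.add_mem_sup ⟨_, rfl⟩ ⟨_, rfl⟩
    · refine sup_le ?_ ?_
      · rintro _ ⟨v, rfl⟩
        exact ⟨Sum.elim v 0, by simp [Matrix.fromCols_mulVec]⟩
      · rintro _ ⟨v, rfl⟩
        exact ⟨Sum.elim 0 v, by simp [Matrix.fromCols_mulVec]⟩
  have hdim := Submodule.finrank_sup_add_finrank_inf_eq
    (LinearMap.range L.mulVecLin) (LinearMap.range R.mulVecLin)
  have hker := L.mulVecLin.finrank_range_add_finrank_ker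
  rw [← hsup] at hdim
  simp only [Matrix.rank] at h
  rw [Module.finrank_fintype_fun_eq_card] at hker
  -- The dimension formula gives `card p + dim (range L ⊓ range R) = rank L = card p - dim (ker L)`,
  -- so both dimensions vanish.
  have hinf : LinearMap.range L.mulVecLin ⊓ LinearMap.range R.mulVecLin = ⊥ :=
    Submodule.finrank_eq_zero.1 (by omega)
  have hker' : LinearMap.ker L.mulVecLin = ⊥ := Submodule.finrank_eq_zero.1 (by omega)
  have hmem : L *ᵥ δ ∈ LinearMap.range L.mulVecLin ⊓ LinearMap.range R.mulVecLin :=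
    ⟨⟨δ, rfl⟩, ⟨-d, by
      rw [Matrix.mulVecLin_apply, Matrix.mulVec_neg]; exact (eq_neg_of_add_eq_zero_left hd).symm⟩⟩
  rw [hinf, Submodule.mem_bot] at hmem
  exact LinearMap.ker_eq_bot'.1 hker' δ hmem

/-! ### Regular descriptor systems as ordinary differential equations -/

theorem hasDerivWithinAt_linearMap {n m : ℕ} (L : (Fin n → ℝ) →ₗ[ℝ] (Fin m → ℝ))
    {x : ℝ → Fin n → ℝ} {v : Fin n → ℝ} {s : Set ℝ} {t : ℝ} (h : HasDerivWithinAt x v s t) :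
    HasDerivWithinAt (fun t => L (x t)) (L v) s t :=
  L.toContinuousLinearMap.hasFDerivAt.comp_hasDerivWithinAt t h

/-- A subspace is the kernel of a linear projection, which commutes with differentiation. -/
theorem mem_of_hasDerivWithinAt {n : ℕ} (V : Submodule ℝ (Fin n → ℝ)) {x : ℝ → Fin n → ℝ}
    {v : Fin n → ℝ} {s : Set ℝ} {t : ℝ} (hs : UniqueDiffWithinAt ℝ s t) (ht : t ∈ s)
    (hx : ∀ t ∈ s, x t ∈ V) (h : HasDerivWithinAt x v s t) : v ∈ V := by
  obtain ⟨W, hW⟩ := V.exists_isCompl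
  have hk := Submodule.ker_projection hW.symm
  have h0 : ∀ t ∈ s, (W.projection V hW.symm) (x t) = 0 := fun t ht => by
    rw [← LinearMap.mem_ker, hk]; exact hx t ht
  rw [← hk, LinearMap.mem_ker]
  exact hs.eq_deriv s (hasDerivWithinAt_linearMap _ h)
    ((hasDerivWithinAt_const t s 0).congr h0 (h0 t ht))

/-- The trajectories of a regular descriptor system solve an ordinary differential equation. -/
theorem exists_linearMap_hasDerivWithinAt {n : ℕ} (E A : Matrix (Fin n) (Fin n) ℝ) {u : ℝ}
    (hu : u ≠ 0) (hdet : (E - u • A).det ≠ 0) :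
    ∃ M : Module.End ℝ (Fin n → ℝ), ∀ (s : Set ℝ) (x : ℝ → Fin n → ℝ), UniqueDiffOn ℝ s →
      (∀ t ∈ s, ∃ v, HasDerivWithinAt x v s t ∧ A *ᵥ x t - E *ᵥ v = 0) →
      ∀ t ∈ s, HasDerivWithinAt x (M (x t)) s t := by
  set K : Module.End ℝ (Fin n → ℝ) := ((E - u • A)⁻¹ * E).mulVecLin with hK
  -- Fitting decomposition of `K`. The exponent `N + 1` used below is positive, so `ker K` lies in
  -- `ker (K ^ (N + 1))` and meets the stable range trivially.
  obtain ⟨N, hN⟩ := Filter.eventually_atTop.1 K.eventually_isCompl_ker_pow_range_pow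
  have hinj : LinearMap.ker (K.domRestrict (LinearMap.range (K ^ (N + 1)))) = ⊥ := by
    rw [LinearMap.ker_eq_bot']
    rintro ⟨w, hw⟩ h
    have h1 : w ∈ LinearMap.ker (K ^ (N + 1)) := by
      rw [LinearMap.mem_ker, pow_succ, Module.End.mul_apply]
      rw [LinearMap.domRestrict_apply] at h
      simp [h]
    exact Subtype.ext (Submodule.disjoint_def.1 (hN (N + 1) (by omega)).disjoint w h1 hw)
  obtain ⟨G, hG⟩ := LinearMap.exists_leftInverse_of_injective _ hinj
  -- On the stable range, `x = K (x - u v)` inverts to `x - u v = G x`; solving for `v` gives this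
  -- map.
  refine ⟨u⁻¹ • (LinearMap.id - (Submodule.subtype _).comp G), fun s x hs hx => ?_⟩
  have hKx : ∀ t ∈ s, ∀ v, HasDerivWithinAt x v s t → x t = K (x t - u • v) := by
    intro t ht v hv
    obtain ⟨v', hv', h⟩ := hx t ht
    obtain rfl : v = v' := (hs t ht).eq_deriv s hv hv'
    have h2 : E *ᵥ (x t - u • v) = (E - u • A) *ᵥ x t := by
      rw [Matrix.mulVec_sub, Matrix.mulVec_smul, Matrix.sub_mulVec, Matrix.smul_mulVec,
        ← sub_eq_zero.1 h]
    rw [hK, Matrix.mulVecLin_apply, ← Matrix.mulVec_mulVec, h2, Matrix.mulVec_mulVec,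
      Matrix.nonsing_inv_mul _ (isUnit_iff_ne_zero.2 hdet), Matrix.one_mulVec]
  -- If `x` stays in `range (K ^ j)`, so does `v`, and then `x = K (x - u v)` lies in the next
  -- range.
  have hrange : ∀ j : ℕ, ∀ t ∈ s, x t ∈ LinearMap.range (K ^ j) := by
    intro j
    induction j with
    | zero => intro t _; exact ⟨x t, by simp⟩
    | succ j ih =>
      intro t ht
      obtain ⟨v, hv, -⟩ := hx t ht
      obtain ⟨w, hw⟩ := Submodule.sub_mem _ (ih t ht)
        (Submodule.smul_mem _ u (mem_of_hasDerivWithinAt _ (hs t ht) ht ih hv))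
      exact ⟨w, by rw [pow_succ', Module.End.mul_apply, hw, ← hKx t ht v hv]⟩
  intro t ht
  obtain ⟨v, hv, -⟩ := hx t ht
  convert hv using 1
  have hmem := Submodule.sub_mem _ (hrange (N + 1) t ht)
    (Submodule.smul_mem _ u (mem_of_hasDerivWithinAt _ (hs t ht) ht (hrange (N + 1)) hv))
  have h3 := LinearMap.congr_fun hG ⟨_, hmem⟩
  rw [LinearMap.comp_apply, LinearMap.domRestrict_apply, ← hKx t ht v hv] at h3
  simp [h3, smul_smul, hu]

theorem hasDerivWithinAt_pow_apply {n : ℕ} {M : Module.End ℝ (Fin n → ℝ)} {x : ℝ → Fin n → ℝ}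
    {s : Set ℝ} (hx : ∀ t ∈ s, HasDerivWithinAt x (M (x t)) s t) (k : ℕ) {t : ℝ} (ht : t ∈ s) :
    HasDerivWithinAt (fun t => (M ^ k) (x t)) ((M ^ (k + 1)) (x t)) s t := by
  rw [pow_succ, Module.End.mul_apply]
  exact hasDerivWithinAt_linearMap _ (hx t ht)

theorem iteratedDerivWithin_eq_pow_apply {n : ℕ} {M : Module.End ℝ (Fin n → ℝ)}
    {x : ℝ → Fin n → ℝ} {s : Set ℝ} (hs : UniqueDiffOn ℝ s)
    (hx : ∀ t ∈ s, HasDerivWithinAt x (M (x t)) s t) (k : ℕ) :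
    ∀ t ∈ s, iteratedDerivWithin k x s t = (M ^ k) (x t) := by
  induction k with
  | zero => simp
  | succ k ih =>
    intro t ht
    rw [iteratedDerivWithin_succ]
    exact (((hasDerivWithinAt_pow_apply hx k ht).congr ih (ih t ht)).derivWithin (hs t ht))

/-- A linear relation between two solutions of linear differential equations persists for their
derivatives. -/
theorem linear_relation_pow_apply {n m : ℕ} {M N : Module.End ℝ (Fin n → ℝ)}
    {x y : ℝ → Fin n → ℝ} {s : Set ℝ} (hs : UniqueDiffOn ℝ s)
    (hx : ∀ t ∈ s, HasDerivWithinAt x (M (x t)) s t)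
    (hy : ∀ t ∈ s, HasDerivWithinAt y (N (y t)) s t)
    (L₁ L₂ : (Fin n → ℝ) →ₗ[ℝ] (Fin m → ℝ)) (h : ∀ t ∈ s, L₁ (x t) = L₂ (y t)) (k : ℕ) :
    ∀ t ∈ s, L₁ ((M ^ k) (x t)) = L₂ ((N ^ k) (y t)) := by
  induction k with
  | zero => simpa using h
  | succ k ih =>
    intro t ht
    exact (hs t ht).eq_deriv s (hasDerivWithinAt_linearMap L₁ (hasDerivWithinAt_pow_apply hx k ht))
      ((hasDerivWithinAt_linearMap L₂ (hasDerivWithinAt_pow_apply hy k ht)).congr ih (ih t ht))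

theorem mulVec_pow_succ_apply {n : ℕ} {E A : Matrix (Fin n) (Fin n) ℝ}
    {M : Module.End ℝ (Fin n → ℝ)} {x : ℝ → Fin n → ℝ} {s : Set ℝ} (hs : UniqueDiffOn ℝ s)
    (hx : ∀ t ∈ s, HasDerivWithinAt x (M (x t)) s t)
    (h : ∀ t ∈ s, ∃ v, HasDerivWithinAt x v s t ∧ A *ᵥ x t - E *ᵥ v = 0) (k : ℕ) :
    ∀ t ∈ s, E *ᵥ (M ^ (k + 1)) (x t) = A *ᵥ (M ^ k) (x t) := by
  intro t ht
  rw [pow_succ', Module.End.mul_apply]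
  refine linear_relation_pow_apply hs hx hx (E.mulVecLin.comp M) A.mulVecLin (fun t ht => ?_) k t ht
  obtain ⟨v, hv, hv'⟩ := h t ht
  rw [LinearMap.comp_apply, ← (hs t ht).eq_deriv s hv (hx t ht)]
  exact (sub_eq_zero.1 hv').symm

/-! ### Uniqueness of the flow and regularity of the pencil -/

open Polynomial in
/-- If the pencil `X • E - A` is singular, the homogeneous initial value problem has a nontrivial
polynomial solution. -/
theorem exists_polynomial_solution {n : ℕ} (E A : Matrix (Fin n) (Fin n) ℝ)
    (h : ((X : ℝ[X]) • E.map C - A.map C).det = 0) :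
    ∃ Y : Fin n → ℝ[X], Y ≠ 0 ∧ (∀ i, (Y i).eval 0 = 0) ∧
      ∀ t, (E *ᵥ fun j => (derivative (Y j)).eval t) = A *ᵥ fun j => (Y j).eval t := by
  -- Take `v ≠ 0` in the kernel of the pencil over `ℝ[X]` and substitute `d/dt` for `X`: the
  -- solution is `v(d/dt)` applied to `t ^ d`. With `d` above all degrees it vanishes at `0`.
  obtain ⟨v, hv, hmul⟩ := Matrix.exists_mulVec_eq_zero_iff.2 h
  obtain ⟨d, hd⟩ : ∃ d, ∀ i, (v i).natDegree < d :=
    ⟨(Finset.univ.sup fun i => (v i).natDegree) + 1, fun i =>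
      Nat.lt_succ_of_le (Finset.le_sup (f := fun i => (v i).natDegree) (Finset.mem_univ i))⟩
  have hterm : ∀ k, ((derivative : ℝ[X] →ₗ[ℝ] ℝ[X]) ^ k) (X ^ d) =
      C (d.descFactorial k : ℝ) * X ^ (d - k) := fun k => by
    rw [Module.End.pow_apply, iterate_derivative_X_pow_eq_smul, smul_eq_C_mul]
  have hY : ∀ i, (aeval (derivative : ℝ[X] →ₗ[ℝ] ℝ[X]) (v i)) (X ^ d) =
      ∑ k ∈ Finset.range ((v i).natDegree + 1),
        C ((v i).coeff k * d.descFactorial k) * X ^ (d - k) := fun i => by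
    rw [aeval_eq_sum_range, LinearMap.sum_apply]
    refine Finset.sum_congr rfl fun k _ => ?_
    rw [LinearMap.smul_apply, hterm, smul_eq_C_mul, C_mul, mul_assoc]
  refine ⟨fun i => (aeval (derivative : ℝ[X] →ₗ[ℝ] ℝ[X]) (v i)) (X ^ d), ?_, ?_, ?_⟩
  · obtain ⟨i, hi⟩ := Function.ne_iff.1 hv
    intro h0
    -- The lowest power of `t` comes only from the leading term of `v i`, so its coefficient is
    -- nonzero.
    have h1 := congrArg (coeff · (d - (v i).natDegree)) (congrFun h0 i)
    simp only [hY, finsetSum_coeff, coeff_C_mul_X_pow, Pi.zero_apply, coeff_zero] at h1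
    rw [Finset.sum_eq_single (v i).natDegree, if_pos rfl] at h1
    · refine mul_ne_zero (leadingCoeff_ne_zero.2 hi) ?_ h1
      exact Nat.cast_ne_zero.2 (Nat.descFactorial_pos.2 (hd i).le).ne'
    · intro k hk hne
      have := Finset.mem_range.1 hk
      have := hd i
      exact if_neg (by omega)
    · simp
  · intro i
    simp only [hY, eval_finsetSum, eval_mul, eval_pow, eval_X, eval_C]
    refine Finset.sum_eq_zero fun k hk => ?_
    have := Finset.mem_range.1 hk
    have := hd i
    rw [zero_pow (by omega), mul_zero]
  · intro t
    ext i
    have h1 := congrArg (fun P => (aeval (derivative : ℝ[X] →ₗ[ℝ] ℝ[X]) P (X ^ d)).eval t)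
      (congrFun hmul i)
    have h2 : (((X : ℝ[X]) • E.map C - A.map C) *ᵥ v) i =
        ∑ j, (E i j • (X * v j) - A i j • v j) := by
      simp [Matrix.mulVec, dotProduct, smul_eq_C_mul, sub_mul, mul_assoc, mul_left_comm]
    rw [h2] at h1
    simp only [map_sum, map_sub, map_smul, map_mul, aeval_X, LinearMap.sum_apply,
      LinearMap.sub_apply, LinearMap.smul_apply, Module.End.mul_apply, eval_finsetSum, eval_sub,
      eval_smul, Pi.zero_apply, map_zero, LinearMap.zero_apply, eval_zero, smul_eq_mul,
      Finset.sum_sub_distrib] at h1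
    exact sub_eq_zero.1 h1

-- Otherwise adding the polynomial solution, shifted to `t₀`, to `x` gives a second trajectory from
-- `x₀`; by uniqueness that polynomial vanishes on an interval, hence identically.
open Polynomial in
theorem det_ne_zero_of_isFlow {n p : ℕ} {E : Matrix (Fin n) (Fin n) ℝ}
    {A : (Fin p → ℝ) → Matrix (Fin n) (Fin n) ℝ} {θ : Fin p → ℝ} {t₀ T : ℝ} {x₀ : Fin n → ℝ}
    {x : ℝ → Fin n → ℝ} (hT : 0 < T) (hx : IsFlow (linearF E A) θ t₀ T x₀ x) :
    ((X : ℝ[X]) • E.map C - (A θ).map C).det ≠ 0 := by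
  intro h
  obtain ⟨Y, hY, hY0, hYE⟩ := exists_polynomial_solution E (A θ) h
  obtain ⟨htraj, hx0, huniq⟩ := hx
  have heq := huniq (fun t => x t + fun i => (Y i).eval (t - t₀)) ?_ ?_
  · apply hY
    ext1 i
    refine eq_zero_of_infinite_isRoot _ ((Set.Icc_infinite hT).mono fun t ht => ?_)
    have h1 := congrFun (heq (x := t₀ + t) ⟨by linarith [ht.1], by linarith [ht.2]⟩) i
    simpa using h1
  · intro t ht
    obtain ⟨v, hv, hF⟩ := htraj t ht
    refine ⟨v + fun i => (derivative (Y i)).eval (t - t₀), hv.add ?_, ?_⟩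
    · refine hasDerivWithinAt_pi.2 fun i => ?_
      exact (((Y i).hasDerivAt (t - t₀)).comp_sub_const t t₀).hasDerivWithinAt
    · have h2 := hYE (t - t₀)
      simp only [linearF, Matrix.mulVec_add] at hF ⊢
      rw [h2, add_sub_add_right_eq_sub, hF]
  · ext i
    simp [hx0, hY0]

open Polynomial in
/-- A regular pencil can be inverted at some nonzero point. -/
theorem exists_det_sub_smul_ne_zero {n : ℕ} {E A : Matrix (Fin n) (Fin n) ℝ}
    (h : ((X : ℝ[X]) • E.map C - A.map C).det ≠ 0) : ∃ u : ℝ, u ≠ 0 ∧ (E - u • A).det ≠ 0 := by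
  by_contra! hu
  refine h (eq_zero_of_infinite_isRoot _ ((Set.Ioi_infinite (0 : ℝ)).mono fun s hs => ?_))
  have hs' : s ≠ 0 := (Set.mem_Ioi.1 hs).ne'
  have h1 : (evalRingHom s).mapMatrix ((X : ℝ[X]) • E.map C - A.map C) = s • (E - s⁻¹ • A) := by
    ext i j
    simp [mul_sub, hs', mul_comm (E i j)]
  rw [Set.mem_ofPred_eq, IsRoot, ← coe_evalRingHom, RingHom.map_det, h1, Matrix.det_smul,
    hu _ (inv_ne_zero hs'), mul_zero]

/-! ### Jets as formal power series -/

open PowerSeries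

theorem coeff_map_C_mulVec {m n : ℕ} (M : Matrix (Fin m) (Fin n) ℝ) (v : Fin n → ℝ⟦X⟧) (k : ℕ)
    (i : Fin m) : coeff k ((M.map C *ᵥ v) i) = (M *ᵥ fun j => coeff k (v j)) i := by
  simp [Matrix.mulVec, dotProduct, coeff_C_mul]

/-- The vector of power series `∑ ξ k X ^ k`. -/
noncomputable def jetSeries {n : ℕ} (ξ : ℕ → Fin n → ℝ) : Fin n → ℝ⟦X⟧ :=
  fun i => PowerSeries.mk fun k => ξ k i

theorem coeff_jetSeries {n : ℕ} (ξ : ℕ → Fin n → ℝ) (k : ℕ) :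
    (fun i => coeff k (jetSeries ξ i)) = ξ k := by
  ext i
  simp [jetSeries]

/-- The pencil `E - X A` over the power series in `X`. -/
noncomputable def pencil {n : ℕ} (E A : Matrix (Fin n) (Fin n) ℝ) :
    Matrix (Fin n) (Fin n) ℝ⟦X⟧ :=
  E.map C - (X : ℝ⟦X⟧) • A.map C

theorem pencil_mulVec {n : ℕ} (E A : Matrix (Fin n) (Fin n) ℝ) (v : Fin n → ℝ⟦X⟧) :
    pencil E A *ᵥ v = E.map C *ᵥ v - A.map C *ᵥ ((X : ℝ⟦X⟧) • v) := by
  rw [pencil, Matrix.sub_mulVec, Matrix.smul_mulVec, Matrix.mulVec_smul]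

/-- Up to the factor `X / det (pencil E A)`, the output `D` of the forced system
`pencil E A *ᵥ D = X • B ξ`. -/
noncomputable def forcedOutput {n q : ℕ} (E : Matrix (Fin n) (Fin n) ℝ)
    (G : Matrix (Fin q) (Fin n) ℝ) (ξ : ℕ → Fin n → ℝ) (A B : Matrix (Fin n) (Fin n) ℝ) :
    Fin q → ℝ⟦X⟧ :=
  G.map C *ᵥ ((pencil E A).adjugate *ᵥ (B.map C *ᵥ jetSeries ξ))

theorem forcedOutput_sub_eq_zero {n q : ℕ} {E A A' : Matrix (Fin n) (Fin n) ℝ}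
    {G : Matrix (Fin q) (Fin n) ℝ} {ξ ξ' : ℕ → Fin n → ℝ}
    (h : ∀ k, E *ᵥ ξ (k + 1) = A *ᵥ ξ k) (h' : ∀ k, E *ᵥ ξ' (k + 1) = A' *ᵥ ξ' k)
    (h₀ : E *ᵥ ξ' 0 = E *ᵥ ξ 0) (hG : ∀ k, G *ᵥ ξ' k = G *ᵥ ξ k) :
    forcedOutput E G ξ A' (A' - A) = 0 := by
  set D := jetSeries (fun k => ξ' k - ξ k) with hD
  have hGD : G.map C *ᵥ D = 0 := by
    ext i k
    rw [coeff_map_C_mulVec, hD, coeff_jetSeries, Matrix.mulVec_sub, hG]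
    simp
  have hED : pencil E A' *ᵥ D = (X : ℝ⟦X⟧) • ((A' - A).map C *ᵥ jetSeries ξ) := by
    rw [pencil_mulVec]
    ext i k
    rw [Pi.sub_apply, map_sub, coeff_map_C_mulVec, coeff_map_C_mulVec, hD, coeff_jetSeries,
      Pi.smul_apply, smul_eq_mul]
    cases k with
    -- The initial condition enters only in this constant coefficient, and only through `E`.
    | zero => simp [Matrix.mulVec_sub, h₀, ← Pi.zero_def]
    | succ k =>
      simp only [Pi.smul_apply, smul_eq_mul, coeff_succ_X_mul]
      rw [coeff_jetSeries, coeff_map_C_mulVec, coeff_jetSeries]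
      simp only [Matrix.mulVec_sub, Matrix.sub_mulVec, h, h', Pi.sub_apply]
      ring
  -- The adjugate turns the left side of `hED` into `det • D`, whose output is zero.
  have h1 : (X : ℝ⟦X⟧) • forcedOutput E G ξ A' (A' - A) = 0 := by
    rw [forcedOutput, ← Matrix.mulVec_smul, ← Matrix.mulVec_smul, ← hED,
      Matrix.mulVec_mulVec D, Matrix.adjugate_mul, Matrix.smul_mulVec, Matrix.one_mulVec, Matrix.mulVec_smul, hGD,
      smul_zero]
  exact (smul_eq_zero.1 h1).resolve_left X_ne_zero

theorem forcedOutput_smul {n q : ℕ} (E : Matrix (Fin n) (Fin n) ℝ)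
    (G : Matrix (Fin q) (Fin n) ℝ) (ξ : ℕ → Fin n → ℝ) (A B : Matrix (Fin n) (Fin n) ℝ) (c : ℝ) :
    forcedOutput E G ξ A (c • B) = C c • forcedOutput E G ξ A B := by
  have : (c • B).map C = C c • B.map C := by
    ext1 i j
    simp
  simp only [forcedOutput, this, Matrix.smul_mulVec, Matrix.mulVec_smul]

-- The adjugate is polynomial in the entries. A solution divided by the determinant would not do,
-- since the `X`-adic order of the determinant can jump as `A` varies.
open scoped PowerSeries.WithPiTopology in
theorem continuous_forcedOutput {n q : ℕ} (E : Matrix (Fin n) (Fin n) ℝ)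
    (G : Matrix (Fin q) (Fin n) ℝ) (ξ : ℕ → Fin n → ℝ) :
    Continuous fun P : Matrix (Fin n) (Fin n) ℝ × Matrix (Fin n) (Fin n) ℝ =>
      forcedOutput E G ξ P.1 P.2 := by
  have hC : Continuous (C (R := ℝ)) := PowerSeries.WithPiTopology.continuous_C
  have hp : Continuous fun P : Matrix (Fin n) (Fin n) ℝ × Matrix (Fin n) (Fin n) ℝ =>
      pencil E P.1 := by
    have hX : Continuous fun P : Matrix (Fin n) (Fin n) ℝ × Matrix (Fin n) (Fin n) ℝ =>
        (X : ℝ⟦X⟧) • P.1.map C :=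
      continuous_matrix fun i j =>
        continuous_const.mul (hC.comp (continuous_fst.matrix_elem i j))
    exact continuous_const.sub hX
  exact continuous_const.matrix_mulVec (hp.matrix_adjugate.matrix_mulVec
    ((continuous_snd.matrix_map hC).matrix_mulVec continuous_const))

/-- For a regular pencil, a forced system with vanishing output has a jet with vanishing output. -/
theorem exists_jet_of_forcedOutput_eq_zero {n q : ℕ} {E A B : Matrix (Fin n) (Fin n) ℝ}
    {G : Matrix (Fin q) (Fin n) ℝ} {ξ : ℕ → Fin n → ℝ} (hdet : (pencil E A).det ≠ 0)
    (h : forcedOutput E G ξ A B = 0) :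
    ∃ d : ℕ → Fin n → ℝ, ∀ k, E *ᵥ d (k + 1) = A *ᵥ d k + B *ᵥ ξ k ∧ G *ᵥ d k = 0 := by
  -- Here `det * w = X ^ m` with `w` a unit, so multiplying the adjugate by `w` solves the system
  -- with right side delayed by `m`.
  obtain ⟨m, w, hw⟩ := IsDiscreteValuationRing.associated_pow_irreducible hdet X_irreducible
  set D : Fin n → ℝ⟦X⟧ := (w : ℝ⟦X⟧) • ((pencil E A).adjugate *ᵥ (B.map C *ᵥ jetSeries ξ)) with hD
  have hGD : G.map C *ᵥ D = 0 := by
    rw [hD, Matrix.mulVec_smul, ← forcedOutput, h, smul_zero]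
  have hED : pencil E A *ᵥ D = (X ^ m : ℝ⟦X⟧) • (B.map C *ᵥ jetSeries ξ) := by
    rw [hD, Matrix.mulVec_smul, Matrix.mulVec_mulVec, Matrix.mul_adjugate, Matrix.smul_mulVec,
      Matrix.one_mulVec, smul_smul, mul_comm, hw]
  -- Shifting by `m` undoes the delay. The factor `X` makes `d k` the coefficient of `D` at `m + k -
  -- 1`, read as zero when `m = k = 0`.
  refine ⟨fun k i => coeff (m + k) (((X : ℝ⟦X⟧) • D) i), fun k => ⟨?_, ?_⟩⟩
  · ext i
    have h1 := congrArg (coeff (m + k)) (congrFun hED i)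
    rw [pencil_mulVec, Pi.sub_apply, map_sub, coeff_map_C_mulVec, coeff_map_C_mulVec,
      Pi.smul_apply, smul_eq_mul, add_comm m k, coeff_X_pow_mul, coeff_map_C_mulVec,
      coeff_jetSeries, sub_eq_iff_eq_add', add_comm k m] at h1
    rw [Pi.add_apply, ← h1]
    simp only [← add_assoc, Pi.smul_apply, smul_eq_mul, coeff_succ_X_mul]
  · ext i
    have h1 : G.map C *ᵥ ((X : ℝ⟦X⟧) • D) = 0 := by rw [Matrix.mulVec_smul, hGD, smul_zero]
    rw [← coeff_map_C_mulVec, h1]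
    simp

theorem det_pencil_ne_zero {n : ℕ} {E A : Matrix (Fin n) (Fin n) ℝ} {u : ℝ}
    (h : (E - u • A).det ≠ 0) : (pencil E A).det ≠ 0 := by
  intro h0
  have h1 : pencil E A = (Polynomial.coeToPowerSeries.ringHom).mapMatrix
      (E.map Polynomial.C - (Polynomial.X : Polynomial ℝ) • A.map Polynomial.C) := by
    ext1 i j
    simp [pencil, mul_comm X]
  rw [h1, ← RingHom.map_det, Polynomial.coeToPowerSeries.ringHom_apply,
    Polynomial.coe_eq_zero_iff] at h0
  have h2 : (Polynomial.evalRingHom u).mapMatrix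
      (E.map Polynomial.C - (Polynomial.X : Polynomial ℝ) • A.map Polynomial.C) = E - u • A := by
    ext i j
    simp [mul_comm u]
  rw [← h2, ← RingHom.map_det, h0, map_zero] at h
  exact h rfl

/-! ### Limiting directions and the rank criterion -/

/-- The directional derivative of `A` at `θ` along `δ`, entry by entry. -/
noncomputable def directionalDeriv {n p : ℕ} (A : (Fin p → ℝ) → Matrix (Fin n) (Fin n) ℝ)
    (θ δ : Fin p → ℝ) : Matrix (Fin n) (Fin n) ℝ :=
  Matrix.of fun i j => fderiv ℝ (fun θ => A θ i j) θ δ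

theorem I₁₁_mulVec {n p : ℕ} {A : (Fin p → ℝ) → Matrix (Fin n) (Fin n) ℝ} {θ : Fin p → ℝ}
    (hA : ∀ i j, DifferentiableAt ℝ (fun θ => A θ i j) θ) (μ : ℕ)
    (z : Fin (μ + 1 + 1) × Fin n → ℝ) (δ : Fin p → ℝ) (r : Fin (μ + 1) × Fin n) :
    (I₁₁ A μ θ z *ᵥ δ) r = (directionalDeriv A θ δ *ᵥ fun i => z (r.1.castSucc, i)) r.2 := by
  have h : HasFDerivAt (fun θ' => (A θ' *ᵥ fun i => z (r.1.castSucc, i)) r.2)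
      (∑ j, z (r.1.castSucc, j) • fderiv ℝ (fun θ => A θ r.2 j) θ) θ := by
    simp only [Matrix.mulVec, dotProduct]
    exact HasFDerivAt.fun_sum fun j _ => (hA r.2 j).hasFDerivAt.mul_const _
  have hsum : ∀ f : (Fin p → ℝ) →L[ℝ] ℝ, ∑ j, f (Pi.single j 1) * δ j = f δ := fun f => by
    conv_rhs => rw [← Finset.univ_sum_single δ, map_sum]
    refine Finset.sum_congr rfl fun j _ => ?_
    rw [mul_comm, ← smul_eq_mul, ← map_smul, ← Pi.single_smul, smul_eq_mul, mul_one]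
  calc (I₁₁ A μ θ z *ᵥ δ) r
      = ∑ j, fderiv ℝ (fun θ' => (A θ' *ᵥ fun i => z (r.1.castSucc, i)) r.2) θ (Pi.single j 1) *
          δ j := rfl
    _ = _ := by
      rw [hsum, h.fderiv]
      simp [Matrix.mulVec, dotProduct, directionalDeriv, mul_comm]

open Filter in
open scoped PowerSeries.WithPiTopology in
/-- If the outputs are indistinguishable, the identifiability matrix annihilates a vector with
nonzero parameter component. -/
theorem exists_direction_of_frequently {n p q : ℕ} {E : Matrix (Fin n) (Fin n) ℝ}
    {A : (Fin p → ℝ) → Matrix (Fin n) (Fin n) ℝ} {G : Matrix (Fin q) (Fin n) ℝ} {θ₀ : Fin p → ℝ}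
    (hA : ∀ i j, DifferentiableAt ℝ (fun θ => A θ i j) θ₀) {ξ : ℕ → Fin n → ℝ}
    (h : ∃ᶠ θ in 𝓝[≠] θ₀, forcedOutput E G ξ (A θ) (A θ - A θ₀) = 0) :
    ∃ δ : Fin p → ℝ, δ ≠ 0 ∧ forcedOutput E G ξ (A θ₀) (directionalDeriv A θ₀ δ) = 0 := by
  have : NeBot (𝓝[≠] θ₀ ⊓ 𝓟 {θ | forcedOutput E G ξ (A θ) (A θ - A θ₀) = 0}) :=
    frequently_mem_iff_neBot.1 h
  -- An ultrafilter replaces the choice of a subsequence: the normalized differences converge on the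
  -- compact unit sphere.
  set 𝒰 := Ultrafilter.of (𝓝[≠] θ₀ ⊓ 𝓟 {θ | forcedOutput E G ξ (A θ) (A θ - A θ₀) = 0})
  have hle := Ultrafilter.of_le (𝓝[≠] θ₀ ⊓ 𝓟 {θ | forcedOutput E G ξ (A θ) (A θ - A θ₀) = 0})
  have hne : ∀ᶠ θ in 𝒰, θ ≠ θ₀ := (hle.trans inf_le_left) self_mem_nhdsWithin
  have hbad : ∀ᶠ θ in 𝒰, forcedOutput E G ξ (A θ) (A θ - A θ₀) = 0 :=
    (hle.trans inf_le_right) (mem_principal_self _)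
  have hlim : Tendsto id (𝒰 : Filter (Fin p → ℝ)) (𝓝 θ₀) :=
    (hle.trans inf_le_left).trans nhdsWithin_le_nhds
  obtain ⟨δ, hδ, hlimδ⟩ := (isCompact_sphere (0 : Fin p → ℝ) 1).ultrafilter_le_nhds
    (𝒰.map fun θ => ‖θ - θ₀‖⁻¹ • (θ - θ₀)) (by
      rw [le_principal_iff, Ultrafilter.mem_coe, Ultrafilter.mem_map, ← Ultrafilter.mem_coe]
      filter_upwards [hne] with θ hθ
      have : ‖θ - θ₀‖ ≠ 0 := norm_ne_zero_iff.2 (sub_ne_zero.2 hθ)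
      simp [norm_smul, this])
  refine ⟨δ, ne_zero_of_mem_unit_sphere ⟨δ, hδ⟩, ?_⟩
  have hd : Tendsto (fun θ => θ - θ₀) (𝒰 : Filter (Fin p → ℝ)) (𝓝 0) := by
    simpa using hlim.sub_const θ₀
  have hA' : Tendsto A (𝒰 : Filter (Fin p → ℝ)) (𝓝 (A θ₀)) :=
    tendsto_pi_nhds.2 fun i => tendsto_pi_nhds.2 fun j => (hA i j).continuousAt.tendsto.comp hlim
  have hB : Tendsto (fun θ => ‖θ - θ₀‖⁻¹ • (A θ - A θ₀)) (𝒰 : Filter (Fin p → ℝ))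
      (𝓝 (directionalDeriv A θ₀ δ)) := by
    refine tendsto_pi_nhds.2 fun i => tendsto_pi_nhds.2 fun j => ?_
    -- Differentiability at `θ₀` suffices: increments rescaled by `‖θ - θ₀‖⁻¹` converge to the
    -- derivative along the limit `δ`.
    have := (hA i j).hasFDerivAt.hasFDerivWithinAt (s := Set.univ) |>.lim hd
      (Eventually.of_forall fun _ => Set.mem_univ _) hlimδ
    simpa [directionalDeriv] using this
  have hF := ((continuous_forcedOutput E G ξ).tendsto (A θ₀, directionalDeriv A θ₀ δ)).comp
    (hA'.prodMk_nhds hB)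
  refine tendsto_nhds_unique hF (tendsto_const_nhds.congr' ?_)
  filter_upwards [hbad] with θ hθ
  simp [forcedOutput_smul, hθ]

theorem locallyIdentifiableAt_of_rank {n p q : ℕ}
    {E : Matrix (Fin n) (Fin n) ℝ} {A : (Fin p → ℝ) → Matrix (Fin n) (Fin n) ℝ}
    {G : Matrix (Fin q) (Fin n) ℝ} {θ₀ : Fin p → ℝ}
    (hA : ∀ i j, DifferentiableAt ℝ (fun θ => A θ i j) θ₀) {t₀ T : ℝ} {x₀ : Fin n → ℝ}
    {x : ℝ → Fin n → ℝ} (hT : 0 < T) (hx : IsFlow (linearF E A) θ₀ t₀ T x₀ x) {μ : ℕ}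
    (hrank : (identifiabilityMatrix (linearF E A) (linearH p G) μ μ (μ + 1) θ₀
          (jetAt (μ + 1) t₀ T x)).rank =
        p + (Matrix.fromRows (Δ₁ (μ + 1) ⊗ₖ A θ₀ - Δ₂ (μ + 1) ⊗ₖ E) (Δ₁ (μ + 1) ⊗ₖ G)).rank) :
    LocallyIdentifiableAt (linearF E A) (linearH p G) (fun v => E *ᵥ v) t₀ x₀ θ₀ := by
  have hs : UniqueDiffOn ℝ (Set.Icc t₀ (t₀ + T)) := uniqueDiffOn_Icc (by linarith)
  have ht₀ : t₀ ∈ Set.Icc t₀ (t₀ + T) := ⟨le_rfl, by linarith⟩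
  obtain ⟨u, hu, hdet⟩ := exists_det_sub_smul_ne_zero (det_ne_zero_of_isFlow hT hx)
  have hcont : ContinuousAt (fun θ => (E - u • A θ).det) θ₀ := by
    have hA' : ContinuousAt A θ₀ :=
      continuousAt_pi.2 fun i => continuousAt_pi.2 fun j => (hA i j).continuousAt
    have : Continuous fun M : Matrix (Fin n) (Fin n) ℝ => (E - u • M).det :=
      (continuous_const.sub (continuous_id.const_smul u)).matrix_det
    exact this.continuousAt.comp hA'
  obtain ⟨M, hM⟩ := exists_linearMap_hasDerivWithinAt E (A θ₀) hu hdet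
  have hxM := hM _ x hs hx.1
  by_contra hnot
  have hfreq : ∃ᶠ θ in 𝓝[≠] θ₀,
      forcedOutput E G (fun k => (M ^ k) (x t₀)) (A θ) (A θ - A θ₀) = 0 := by
    intro hev
    -- The neighborhood also keeps `(E - u • A θ).det` nonzero for the same `u`, so trajectories for
    -- `θ` are smooth too.
    refine hnot ⟨_, (eventually_nhdsWithin_iff.1 hev).and (hcont.eventually_ne hdet),
      fun θ hθ hne => ⟨T, hT, x, hx, fun x' hx' hE => ?_⟩⟩
    obtain ⟨hθ₁, hθ₂⟩ := hθ
    by_contra! hout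
    obtain ⟨N, hN⟩ := exists_linearMap_hasDerivWithinAt E (A θ) hu hθ₂
    have hxN := hN _ x' hs hx'
    refine hθ₁ hne (forcedOutput_sub_eq_zero (ξ' := fun k => (N ^ k) (x' t₀))
      (fun k => mulVec_pow_succ_apply hs hxM hx.1 k t₀ ht₀)
      (fun k => mulVec_pow_succ_apply hs hxN hx' k t₀ ht₀) ?_ fun k => ?_)
    · simpa [hx.2.1] using hE
    · exact linear_relation_pow_apply hs hxN hxM G.mulVecLin G.mulVecLin
        (fun t ht => (hout t ht).symm) k t₀ ht₀
  obtain ⟨δ, hδ, hout⟩ := exists_direction_of_frequently hA hfreq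
  obtain ⟨d, hd⟩ := exists_jet_of_forcedOutput_eq_zero (det_pencil_ne_zero hdet) hout
  rw [identifiabilityMatrix_linear, ← Matrix.fromCols_fromRows_eq_fromBlocks] at hrank
  -- The truncation of `d` to orders at most `μ + 1`, together with `δ`, is the kernel vector.
  refine hδ (eq_zero_of_rank_fromCols_eq _ _ (by rw [hrank, Fintype.card_fin])
    (d := fun r : Fin (μ + 1 + 1) × Fin n => d r.1 r.2) ?_)
  have hjet : ∀ k : Fin (μ + 1 + 1), (fun i => jetAt (μ + 1) t₀ T x (k, i)) =
      (M ^ (k : ℕ)) (x t₀) := fun k => iteratedDerivWithin_eq_pow_apply hs hxM k t₀ ht₀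
  rw [Matrix.fromRows_mulVec, Matrix.fromRows_mulVec]
  ext (r | r)
  · simp only [Pi.add_apply, Sum.elim_inl, Pi.zero_apply, Matrix.sub_mulVec, Pi.sub_apply,
      I₁₁_mulVec hA, Δ₁_kronecker_mulVec, Δ₂_kronecker_mulVec, hjet]
    have := congrFun (hd r.1).1 r.2
    simp only [Fin.val_succ, Fin.val_castSucc]
    rw [Pi.add_apply] at this
    linarith
  · simp only [Pi.add_apply, Sum.elim_inr, Pi.zero_apply, Matrix.zero_mulVec, zero_add,
      Δ₁_kronecker_mulVec, Fin.val_castSucc]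
    exact congrFun (hd r.1).2 r.2

end DescriptorSystem

theorem corollary2 {n p q : ℕ}
    (E : Matrix (Fin n) (Fin n) ℝ) (A : (Fin p → ℝ) → Matrix (Fin n) (Fin n) ℝ)
    (C : Matrix (Fin q) (Fin n) ℝ) (θ₀ : Fin p → ℝ)
    (hA : ∀ i j, DifferentiableAt ℝ (fun θ => A θ i j) θ₀) :
    (∀ (μ : ℕ) (z : Fin (μ + 1 + 1) × Fin n → ℝ),
      DescriptorSystem.identifiabilityMatrix (DescriptorSystem.linearF E A)
          (DescriptorSystem.linearH p C) μ μ (μ + 1) θ₀ z =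
        Matrix.fromBlocks
          (DescriptorSystem.I₁₁ A μ θ₀ z)
          (DescriptorSystem.Δ₁ (μ + 1) ⊗ₖ A θ₀ - DescriptorSystem.Δ₂ (μ + 1) ⊗ₖ E)
          0
          (DescriptorSystem.Δ₁ (μ + 1) ⊗ₖ C)) ∧
    (∀ (t₀ T : ℝ) (x₀ : Fin n → ℝ) (x : ℝ → Fin n → ℝ), 0 < T →
      DescriptorSystem.IsFlow (DescriptorSystem.linearF E A) θ₀ t₀ T x₀ x →
      (∃ μ : ℕ,
        (DescriptorSystem.identifiabilityMatrix (DescriptorSystem.linearF E A)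
            (DescriptorSystem.linearH p C) μ μ (μ + 1) θ₀
            (DescriptorSystem.jetAt (μ + 1) t₀ T x)).rank =
          p + (Matrix.fromRows
            (DescriptorSystem.Δ₁ (μ + 1) ⊗ₖ A θ₀ - DescriptorSystem.Δ₂ (μ + 1) ⊗ₖ E)
            (DescriptorSystem.Δ₁ (μ + 1) ⊗ₖ C)).rank) →
      DescriptorSystem.LocallyIdentifiableAt (DescriptorSystem.linearF E A)
        (DescriptorSystem.linearH p C) (fun v => E *ᵥ v) t₀ x₀ θ₀) := by
  exact ⟨DescriptorSystem.identifiabilityMatrix_linear E A C θ₀, fun _ _ _ _ hT hx ⟨_, hrank⟩ =>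
    DescriptorSystem.locallyIdentifiableAt_of_rank hA hT hx hrank⟩
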